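/- Let $n\ge 1$. A convex body in $\mathbb{R}^n$ is a nonempty compact convex set $K$; its support function is $h(K,u)=\max\{\langle x,u\rangle : x\in K\}$, and $K$ has constant width $1$ if $h(K,u)+h(K,-u)=1$ for all $u\in\mathbb{S}^{n-1}$. Let $u\in\mathbb{S}^{n-1}$ be such that exactly one point $x\in K$ satisfies $\langle x,u\rangle=h(K,u)$ (for bodies of constant width this holds for every $u$), and let $t\in u^\perp\cap\mathbb{S}^{n-1}$. Let $\overline K$ be the orthogonal projection of $K$ to the plane $L=x+\mathrm{lin}\{u,t\}$ and let $E=\{x+\lambda u+\mu t:\lambda\in\mathbb{R},\ \mu>0\}$. For a point $z\neq x$ of the boundary of $\overline K$ relative to $L$, let $r(z)\in(0,\infty]$ be the radius of the circle in $L$ through $x$ and $z$ with centre on the ray $\{x-\rho u:\rho\ge 0\}$, with $r(z)=\infty$ if $\langle z-x,u\rangle=0$. The lower and upper tangential radii of curvature of $K$ at $u$ in direction $t$ are $\liminf r(z)$ and $\limsup r(z)$, as $z\to x$ with $z\in E\cap\mathrm{relbd}\,\overline K$; if both are equal, their common value in $[0,\infty]$ is the tangential radius of curvature $\bar\varrho(K,u,t)$.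 Theorem. Let $W_0\subset\mathbb{R}^n$ be a convex body of constant width $1$, let $v\in\mathbb{S}^{n-1}$ and $\varepsilon>0$. Then there exists a convex body $Q\subset\mathbb{R}^n$ of constant width $1$ whose Hausdorff distance from $W_0$ is at most $\varepsilon$ and which has the following property. For each $u\in\mathbb{S}^{n-1}$ with $\langle u,v\rangle\ge 1/2$, either $\bar\varrho(Q,u,t)$ exists and equals $1$ for all $t\in u^\perp\cap\mathbb{S}^{n-1}$, or $\bar\varrho(Q,u,t)$ exists and equals $0$ for at least one $t\in u^\perp\cap\mathbb{S}^{n-1}$. -/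

import Mathlib

open Filter Topology
open scoped ENNReal NNReal

noncomputable section

namespace ConstWidth

/-- Euclidean `n`-space. -/
abbrev Eu (n : ℕ) : Type := EuclideanSpace ℝ (Fin n)

variable {n : ℕ}

/-- The support function `h(K, u) = max {⟪x, u⟫ : x ∈ K}` (the supremum is attained since `K` is
nonempty and compact). -/
def supportFn (K : ConvexBody (Eu n)) (u : Eu n) : ℝ :=
  sSup ((fun x : Eu n => inner ℝ x u) '' (K : Set (Eu n)))

/-- `K` is a body of constant width `d`. -/
def HasConstantWidth (K : ConvexBody (Eu n)) (d : ℝ) : Prop :=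
  ∀ u : Eu n, ‖u‖ = 1 → supportFn K u + supportFn K (-u) = d

/-- The support set `F(K, u)`: the points of `K` in the supporting hyperplane with outer
normal vector `u`. -/
def supportSet (K : ConvexBody (Eu n)) (u : Eu n) : Set (Eu n) :=
  {x | x ∈ (K : Set (Eu n)) ∧ inner ℝ x u = supportFn K u}

/-- The radius `r(z)` of the unique circle through `x` and `z` whose centre `x - ρ u`, `ρ ≥ 0`, lies
on the ray from `x` in direction `-u` (for a unit vector `u`); it is `∞` if there is no such
circle, which is the case if `z ≠ x` lies on the line through `x` orthogonal to `u`. -/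
def circleRadius (x u z : Eu n) : ℝ≥0∞ :=
  ⨅ (ρ : ℝ≥0) (_ : dist z (x - (ρ : ℝ) • u) = ρ), (ρ : ℝ≥0∞)

/-- The open halfplane `{x + a u + b t : a ∈ ℝ, b > 0}`. -/
def openHalfplane (x u t : Eu n) : Set (Eu n) :=
  {y | ∃ a b : ℝ, 0 < b ∧ y = x + a • u + b • t}

/-- Lower radius of curvature at the support element `(x, u)` in direction `t` of a
two-dimensional convex set `P` lying in the plane `x + lin {u, t}`. The boundary of `P` is taken
relative to that plane. -/
def lowerRadius (P : Set (Eu n)) (x u t : Eu n) : ℝ≥0∞ :=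
  liminf (circleRadius x u) (𝓝[openHalfplane x u t ∩ intrinsicFrontier ℝ P] x)

/-- Upper radius of curvature at the support element `(x, u)` in direction `t` of a
two-dimensional convex set `P` lying in the plane `x + lin {u, t}`. -/
def upperRadius (P : Set (Eu n)) (x u t : Eu n) : ℝ≥0∞ :=
  limsup (circleRadius x u) (𝓝[openHalfplane x u t ∩ intrinsicFrontier ℝ P] x)

/-- The orthogonal projection of `K` to the affine plane `x + lin {u, t}`. -/
def planeProjection (K : ConvexBody (Eu n)) (x u t : Eu n) : Set (Eu n) :=
  (fun y : Eu n => x + (Submodule.span ℝ {u, t}).starProjection (y - x)) '' (K : Set (Eu n))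

/-- The unit vector `u` is a regular normal vector of `K` (the support set is a single point `x`),
and the tangential radius of curvature of `K` at `u` in direction `t` exists and equals `r`:
the lower and the upper radius of curvature, at `(x, u)` in direction `t`, of the projection of
`K` to `x + lin {u, t}` are both equal to `r`. -/
def TangentialRadiusEq (K : ConvexBody (Eu n)) (u t : Eu n) (r : ℝ≥0∞) : Prop :=
  ∃ x : Eu n, supportSet K u = {x} ∧
    lowerRadius (planeProjection K x u t) x u t = r ∧
    upperRadius (planeProjection K x u t) x u t = r

end ConstWidth

end

/-! Let `R` be a Minkowski combination of the given body with a small portion of a ball of diameter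
one, let `X` be a fine finite net in `R`, and let P = `ballHull X`. Since `R` still has width one, P
is only slightly larger than `R`. Points of `R` at distance one have opposite normals. Thanks to the
ball, support points of `R` with normals in a cap smaller than a hemisphere have distance uniformly
below one, and for a fine net the corresponding points of P keep distance at most one
(`IsUnitWidth.exists_finite_ballHull_approx`).

Hence `X`, together with the set `A` of these boundary points of P, has diameter at most one and
extends to a body `Q` of constant width one (`exists_convexBody_isUnitWidth`). From `X ⊆ Q` follows
`Q ⊆ P`, and from `A ⊆ Q` that `Q` and P share their support points in the cap. There the boundary
consists of pieces of finitely many unit spheres. Either P is locally one ball and all radii are one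
(`IsUnitWidth.tangentialRadiusEq_one`), or another sphere contributes a second normal, towards which
the radius is zero (`IsUnitWidth.exists_tangentialRadiusEq_zero`). -/

namespace ConstWidth

/-! ### Sets of unit width, ball hulls and completion. -/

section InnerProduct

variable {E : Type*} [NormedAddCommGroup E] [InnerProductSpace ℝ E]

/-- A set of diameter at most one that contains a pair of points at distance one in every
direction. -/
structure IsUnitWidth (W : Set E) : Prop where
  norm_sub_le : ∀ x ∈ W, ∀ y ∈ W, ‖x - y‖ ≤ 1
  exists_sub_mem : ∀ u : E, ‖u‖ = 1 → ∃ x ∈ W, x - u ∈ W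

/-- The vector `u` is an outer normal vector of the set `W` at its point `x`. -/
def IsNormalAt (W : Set E) (x u : E) : Prop :=
  x ∈ W ∧ ∀ q ∈ W, inner ℝ q u ≤ inner ℝ x u

theorem eq_of_norm_le_one_of_one_le_inner {a u : E} (ha : ‖a‖ ≤ 1) (hu : ‖u‖ = 1)
    (h : 1 ≤ inner ℝ a u) : a = u := by
  have h1 : ‖a - u‖ ^ 2 = ‖a‖ ^ 2 - 2 * inner ℝ a u + ‖u‖ ^ 2 := norm_sub_sq_real a u
  have h2 : ‖a‖ ^ 2 ≤ 1 := pow_le_one₀ (norm_nonneg a) ha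
  have h3 : ‖a - u‖ ^ 2 ≤ 0 := by rw [h1, hu]; linarith
  have h4 : ‖a - u‖ = 0 := by
    have := sq_nonneg ‖a - u‖
    exact pow_eq_zero_iff two_ne_zero |>.1 (le_antisymm h3 this)
  exact sub_eq_zero.1 (norm_eq_zero.1 h4)

theorem IsUnitWidth.sub_mem {W : Set E} (hW : IsUnitWidth W) {x u : E} (hu : ‖u‖ = 1)
    (hx : IsNormalAt W x u) : x - u ∈ W := by
  obtain ⟨y, hy, hyu⟩ := hW.exists_sub_mem u hu
  have h1 : x - (y - u) = u := by
    refine eq_of_norm_le_one_of_one_le_inner (hW.norm_sub_le _ hx.1 _ hyu) hu ?_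
    have := hx.2 y hy
    simp only [inner_sub_left, real_inner_self_eq_norm_sq, hu]
    linarith
  have h2 : x - u = y - u := by rw [sub_eq_iff_eq_add] at h1 ⊢; rw [h1]; abel
  rwa [h2]

theorem IsUnitWidth.eq_of_isNormalAt {W : Set E} (hW : IsUnitWidth W) {x y u : E} (hu : ‖u‖ = 1)
    (hx : IsNormalAt W x u) (hy : IsNormalAt W y u) : y = x := by
  have h1 : y - (x - u) = u := by
    refine eq_of_norm_le_one_of_one_le_inner
      (hW.norm_sub_le _ hy.1 _ (hW.sub_mem hu hx)) hu ?_
    have := hy.2 x hx.1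
    simp only [inner_sub_left, real_inner_self_eq_norm_sq, hu]
    linarith
  rw [sub_eq_iff_eq_add] at h1
  rw [h1]; abel

/-- The intersection of the closed unit balls with centres in `X`. -/
def ballHull (X : Set E) : Set E := {y | ∀ x ∈ X, ‖y - x‖ ≤ 1}

theorem ballHull_eq_iInter {F : Type*} [NormedAddCommGroup F] (X : Set F) :
    ballHull X = ⋂ x ∈ X, Metric.closedBall x 1 := by
  ext y; simp [ballHull, dist_eq_norm]

theorem isClosed_ballHull {F : Type*} [NormedAddCommGroup F] (X : Set F) : IsClosed (ballHull X) := by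
  rw [ballHull_eq_iInter]
  exact isClosed_biInter fun _ _ => Metric.isClosed_closedBall

theorem convex_ballHull (X : Set E) : Convex ℝ (ballHull X) := by
  rw [ballHull_eq_iInter]
  exact convex_iInter₂ fun x _ => convex_closedBall x 1

theorem isCompact_ballHull [FiniteDimensional ℝ E] {X : Set E} (hX : X.Nonempty) :
    IsCompact (ballHull X) := by
  obtain ⟨x, hx⟩ := hX
  refine (isCompact_closedBall x 1).of_isClosed_subset (isClosed_ballHull X) fun y hy => ?_
  simpa [dist_eq_norm] using hy x hx

/-- An intersection of unit balls is contained in the unit ball that touches it from outside at a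
given boundary point with given outer unit normal vector. -/
theorem norm_sub_le_of_isNormalAt_ballHull {X : Set E} {x u z : E} (hu : ‖u‖ = 1)
    (hx : IsNormalAt (ballHull X) x u) (hz : z ∈ ballHull X) : ‖z - (x - u)‖ ≤ 1 := by
  by_contra! hlt
  set d := z - x with hd
  have hzx : z - (x - u) = d + u := by rw [hd]; abel
  rw [hzx] at hlt
  have hdu : inner ℝ d u ≤ 0 := by
    have := hx.2 z hz
    rw [hd, inner_sub_left]; linarith
  have hsq : 1 < ‖d + u‖ ^ 2 := by nlinarith
  rw [norm_add_sq_real, hu] at hsq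
  set D := ‖d‖ ^ 2 with hD
  set g := inner ℝ d u with hg
  -- If `z` lies outside the touching ball, then `D / 2 + g > 0`. By strict convexity of the balls,
  -- `x + s • d` has room of about `s * D / 2` to move along `u`. Moving by `s * m`, with `m` just
  -- below `D / 2`, raises the height above that of `x` by `s * κ`, which is the contradiction.
  set κ := (D / 2 + g) / 2 with hκ
  have hκ0 : 0 < κ := by rw [hκ]; linarith
  set m := D / 2 - κ with hm
  have hD0 : 0 ≤ D := sq_nonneg _
  have hm0 : 0 ≤ m := by rw [hm, hκ]; linarith
  -- The last bound lets the first-order gain `2 * s * κ` absorb all terms of order `s ^ 2`.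
  obtain ⟨s, hs0, hs1, hs⟩ : ∃ s : ℝ, 0 < s ∧ s ≤ 1 ∧ s * (m ^ 2 + D) ≤ 2 * κ := by
    have hpos : 0 < m ^ 2 + D + 1 := by positivity
    refine ⟨min 1 (2 * κ / (m ^ 2 + D + 1)), by positivity, min_le_left _ _, ?_⟩
    calc min 1 (2 * κ / (m ^ 2 + D + 1)) * (m ^ 2 + D)
        ≤ 2 * κ / (m ^ 2 + D + 1) * (m ^ 2 + D + 1) := by
          exact mul_le_mul (min_le_right _ _) (by linarith) (by positivity) (by positivity)
      _ = 2 * κ := by field_simp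
  have hp : x + s • d + (s * m) • u ∈ ballHull X := by
    intro y hy
    have hxy := hx.1 y hy
    have hzy := hz y hy
    set e := x - y with he
    have h1 : z - y = e + d := by rw [he, hd]; abel
    have h2 : x + s • d + (s * m) • u - y = (e + s • d) + (s * m) • u := by rw [he]; abel
    rw [h1] at hzy
    rw [h2]
    have e1 : ‖e‖ ^ 2 ≤ 1 := pow_le_one₀ (norm_nonneg _) hxy
    have e2 : ‖e + d‖ ^ 2 ≤ 1 := pow_le_one₀ (norm_nonneg _) hzy
    have e3 : ‖e + s • d‖ ^ 2 = (1 - s) * ‖e‖ ^ 2 + s * ‖e + d‖ ^ 2 - s * (1 - s) * D := by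
      rw [norm_add_sq_real, norm_add_sq_real, inner_smul_right, norm_smul, hD,
        Real.norm_eq_abs, mul_pow, sq_abs]
      ring
    have e4 : ‖e + s • d‖ ^ 2 ≤ 1 - s * (1 - s) * D := by
      rw [e3]; nlinarith
    have e5 : ‖e + s • d‖ ≤ 1 := by
      have : 0 ≤ s * (1 - s) * D := mul_nonneg (mul_nonneg hs0.le (by linarith)) hD0
      have h : ‖e + s • d‖ ^ 2 ≤ 1 := by linarith
      exact (sq_le_one_iff₀ (norm_nonneg _)).1 h
    have e6 : inner ℝ (e + s • d) u ≤ 1 := by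
      refine (real_inner_le_norm _ _).trans ?_
      rw [hu, mul_one]; exact e5
    have e7 : ‖(e + s • d) + (s * m) • u‖ ^ 2 ≤ 1 := by
      rw [norm_add_sq_real (e + s • d), inner_smul_right, norm_smul, hu, Real.norm_eq_abs, mul_one,
        sq_abs]
      have hsm : 0 ≤ s * m := mul_nonneg hs0.le hm0
      have h3 : s * m * inner ℝ (e + s • d) u ≤ s * m := by nlinarith
      have h4 : s * (s * (m ^ 2 + D)) ≤ s * (2 * κ) := by gcongr
      have h5 : 2 * (s * m) = s * D - s * (2 * κ) := by rw [hm]; ring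
      nlinarith
    exact (sq_le_one_iff₀ (norm_nonneg _)).1 e7
  have hfin := hx.2 _ hp
  rw [inner_add_left, inner_add_left, inner_smul_left, inner_smul_left,
    real_inner_self_eq_norm_sq, hu, ← hg] at hfin
  simp only [conj_trivial, one_pow, mul_one] at hfin
  have : s * g + s * m = s * κ := by rw [hm, hκ]; ring
  have : 0 < s * κ := by positivity
  linarith

/-- Every nonempty set of diameter at most one is contained in a convex body of constant width
one. -/
theorem exists_convexBody_isUnitWidth [FiniteDimensional ℝ E] {S : Set E} (hS : S.Nonempty)
    (hd : ∀ x ∈ S, ∀ y ∈ S, ‖x - y‖ ≤ 1) :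
    ∃ Q : ConvexBody E, S ⊆ Q ∧ IsUnitWidth (Q : Set E) := by
  obtain ⟨Q, hSQ, hQ⟩ := zorn_subset_nonempty {T : Set E | ∀ x ∈ T, ∀ y ∈ T, ‖x - y‖ ≤ 1} (by
    intro c hc hchain _
    refine ⟨⋃₀ c, ?_, fun s hs => Set.subset_sUnion_of_mem hs⟩
    rintro x ⟨s, hs, hxs⟩ y ⟨t, ht, hyt⟩
    rcases hchain.total hs ht with h | h
    · exact hc ht x (h hxs) y hyt
    · exact hc hs x hxs y (h hyt)) S hd
  have hQd : ∀ x ∈ Q, ∀ y ∈ Q, ‖x - y‖ ≤ 1 := hQ.prop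
  -- Maximality: a point within distance one of all of `Q` could be added to it.
  have hQeq : ballHull Q = Q := by
    refine Set.Subset.antisymm (fun z hz => ?_) fun z hz y hy => hQd z hz y hy
    have hmem : insert z Q ∈ {T : Set E | ∀ x ∈ T, ∀ y ∈ T, ‖x - y‖ ≤ 1} := by
      rintro x (rfl | hx) y (rfl | hy)
      · simp
      · exact hz y hy
      · rw [norm_sub_rev]; exact hz x hx
      · exact hQd x hx y hy
    exact hQ.le_of_ge hmem (Set.subset_insert z Q) (Set.mem_insert z Q)
  have hQne : Q.Nonempty := hS.mono hSQ
  have hcomp : IsCompact Q := hQeq ▸ isCompact_ballHull hQne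
  refine ⟨⟨Q, hQeq ▸ convex_ballHull Q, hcomp, hQne⟩, hSQ, hQd, fun u hu => ?_⟩
  obtain ⟨x, hx, hmax⟩ := hcomp.exists_isMaxOn hQne
    (f := fun y => inner ℝ y u) (by fun_prop)
  refine ⟨x, hx, ?_⟩
  have hn : IsNormalAt (ballHull Q) x u := by
    rw [hQeq]; exact ⟨hx, fun q hq => hmax hq⟩
  have hmem : x - u ∈ ballHull Q := fun z hz => by
    rw [norm_sub_rev]
    exact norm_sub_le_of_isNormalAt_ballHull hu hn (hQeq.symm ▸ hz)
  rwa [hQeq] at hmem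

end InnerProduct

/-! ### Support functions and constant width. -/

section SupportFunction

variable {n : ℕ}

theorem bddAbove_inner_image (K : ConvexBody (Eu n)) (u : Eu n) :
    BddAbove ((fun x : Eu n => inner ℝ x u) '' (K : Set (Eu n))) :=
  (K.isCompact.image (by fun_prop)).bddAbove

theorem inner_le_supportFn (K : ConvexBody (Eu n)) (u : Eu n) {x : Eu n}
    (hx : x ∈ (K : Set (Eu n))) : inner ℝ x u ≤ supportFn K u :=
  le_csSup (bddAbove_inner_image K u) ⟨x, hx, rfl⟩

theorem exists_inner_eq_supportFn (K : ConvexBody (Eu n)) (u : Eu n) :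
    ∃ x ∈ (K : Set (Eu n)), inner ℝ x u = supportFn K u := by
  obtain ⟨x, hx, h⟩ := (K.isCompact.image (f := fun x : Eu n => inner ℝ x u)
    (by fun_prop)).sSup_mem (K.nonempty.image _)
  exact ⟨x, hx, h⟩

theorem mem_supportSet_iff (K : ConvexBody (Eu n)) (u x : Eu n) :
    x ∈ supportSet K u ↔ IsNormalAt (K : Set (Eu n)) x u := by
  constructor
  · rintro ⟨hx, h⟩
    exact ⟨hx, fun q hq => h ▸ inner_le_supportFn K u hq⟩
  · rintro ⟨hx, h⟩
    obtain ⟨y, hy, hyu⟩ := exists_inner_eq_supportFn K u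
    exact ⟨hx, le_antisymm (inner_le_supportFn K u hx) (hyu ▸ h y hy)⟩

/-- Removes the support function from the rest of the argument. Width one in the direction of `x -
y` bounds `‖x - y‖`. Conversely, support points for `u` and `-u` differ by a vector of norm at most
one whose inner product with `u` is one, hence by `u`. -/
theorem hasConstantWidth_one_iff (K : ConvexBody (Eu n)) :
    HasConstantWidth K 1 ↔ IsUnitWidth (K : Set (Eu n)) := by
  constructor
  · intro hK
    have hd : ∀ x ∈ (K : Set (Eu n)), ∀ y ∈ (K : Set (Eu n)), ‖x - y‖ ≤ 1 := by
      intro x hx y hy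
      rcases eq_or_ne (x - y) 0 with h0 | h0
      · simp [h0]
      have hn : ‖x - y‖ ≠ 0 := norm_ne_zero_iff.2 h0
      set u := ‖x - y‖⁻¹ • (x - y) with hu
      have hu1 : ‖u‖ = 1 := norm_smul_inv_norm h0
      have h1 := inner_le_supportFn K u hx
      have h2 := inner_le_supportFn K (-u) hy
      have h3 := hK u hu1
      have h4 : inner ℝ (x - y) u = ‖x - y‖ := by
        rw [hu, inner_smul_right, real_inner_self_eq_norm_sq]; field_simp
      rw [inner_neg_right] at h2
      rw [inner_sub_left] at h4
      linarith
    refine ⟨hd, fun u hu => ?_⟩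
    obtain ⟨x, hx, hxu⟩ := exists_inner_eq_supportFn K u
    obtain ⟨y, hy, hyu⟩ := exists_inner_eq_supportFn K (-u)
    have h1 : x - y = u := by
      refine eq_of_norm_le_one_of_one_le_inner (hd x hx y hy) hu ?_
      have := hK u hu
      rw [inner_neg_right] at hyu
      rw [inner_sub_left]; linarith
    refine ⟨x, hx, ?_⟩
    rwa [← h1, sub_sub_cancel]
  · intro hK u hu
    obtain ⟨x, hx, hxu⟩ := hK.exists_sub_mem u hu
    obtain ⟨a, ha, hau⟩ := exists_inner_eq_supportFn K u
    obtain ⟨b, hb, hbu⟩ := exists_inner_eq_supportFn K (-u)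
    have h1 := inner_le_supportFn K u hx
    have h2 := inner_le_supportFn K (-u) hxu
    rw [inner_neg_right, inner_sub_left, real_inner_self_eq_norm_sq, hu] at h2
    have h3 : inner ℝ (a - b) u ≤ 1 := by
      refine (real_inner_le_norm _ _).trans ?_
      rw [hu, mul_one]; exact hK.norm_sub_le a ha b hb
    rw [inner_sub_left] at h3
    rw [inner_neg_right] at hbu
    linarith

theorem IsUnitWidth.supportSet_eq {K : ConvexBody (Eu n)} (hK : IsUnitWidth (K : Set (Eu n)))
    {x u : Eu n} (hu : ‖u‖ = 1) (hx : IsNormalAt (K : Set (Eu n)) x u) :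
    supportSet K u = {x} := by
  ext y
  rw [mem_supportSet_iff, Set.mem_singleton_iff]
  exact ⟨fun hy => hK.eq_of_isNormalAt hu hx hy, fun h => h ▸ hx⟩

end SupportFunction

/-! ### Criteria for the relative boundary. -/

section IntrinsicFrontier

variable {E : Type*} [NormedAddCommGroup E] [NormedSpace ℝ E]

/-- A point of a set is in the intrinsic frontier if one can leave the set immediately along a ray
inside the affine span. -/
theorem mem_intrinsicFrontier_of_ray {P : Set E} {p d : E} (hp : p ∈ P)
    (hd : ∀ s : ℝ, p + s • d ∈ affineSpan ℝ P) (hout : ∀ s : ℝ, 0 < s → p + s • d ∉ P) :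
    p ∈ intrinsicFrontier ℝ P := by
  set f : ℝ → affineSpan ℝ P := fun s => ⟨p + s • d, hd s⟩ with hf
  have hfc : Continuous f := by fun_prop
  have hf0 : ((f 0 : affineSpan ℝ P) : E) = p := by simp [hf]
  refine mem_intrinsicFrontier.2 ⟨f 0, ⟨subset_closure ?_, fun hint => ?_⟩, hf0⟩
  · simpa [hf0] using hp
  · have h1 : ∀ᶠ s in 𝓝 (0 : ℝ), f s ∈ interior ((↑) ⁻¹' P : Set (affineSpan ℝ P)) :=
      hfc.continuousAt.eventually_mem (isOpen_interior.mem_nhds hint)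
    have h2 : ∀ᶠ s in 𝓝[>] (0 : ℝ), f s ∈ interior ((↑) ⁻¹' P : Set (affineSpan ℝ P)) :=
      nhdsWithin_le_nhds h1
    obtain ⟨s, hs, hs0⟩ := (h2.and self_mem_nhdsWithin).exists
    have hsP : f s ∈ ((↑) ⁻¹' P : Set (affineSpan ℝ P)) := interior_subset hs
    exact hout s hs0 hsP

/-- A point of the intrinsic frontier of a subset of an affine subspace `L` has no neighbourhood
whose trace on `L` is contained in the set. -/
theorem not_mem_intrinsicFrontier_of_nhds {P U : Set E} {p : E} {L : AffineSubspace ℝ E}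
    (hPL : P ⊆ L) (hU : U ∈ 𝓝 p) (hUL : U ∩ L ⊆ P) : p ∉ intrinsicFrontier ℝ P := by
  rintro ⟨y, hy, rfl⟩
  refine hy.2 (mem_interior_iff_mem_nhds.2 ?_)
  refine mem_of_superset (continuous_subtype_val.continuousAt.preimage_mem_nhds hU) ?_
  intro z hz
  exact hUL ⟨hz, affineSpan_le.2 hPL z.2⟩

end IntrinsicFrontier

variable {n : ℕ}

/-! ### Plane projections and tangential radii of curvature. -/

section Plane

variable {x u t : Eu n}

theorem norm_sq_plane (hu : ‖u‖ = 1) (ht : ‖t‖ = 1) (htu : inner ℝ t u = 0) (a b : ℝ) :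
    ‖a • u + b • t‖ ^ 2 = a ^ 2 + b ^ 2 := by
  rw [norm_add_sq_real, norm_smul, norm_smul, hu, ht, inner_smul_left, inner_smul_right,
    real_inner_comm, htu]
  simp

theorem inner_plane_left (hu : ‖u‖ = 1) (htu : inner ℝ t u = 0) (a b : ℝ) :
    inner ℝ (a • u + b • t) u = a := by
  simp [inner_add_left, inner_smul_left, htu, hu]

theorem inner_plane_right (ht : ‖t‖ = 1) (htu : inner ℝ t u = 0) (a b : ℝ) :
    inner ℝ (a • u + b • t) t = b := by
  rw [real_inner_comm] at htu
  simp [inner_add_left, inner_smul_left, htu, ht]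

theorem dist_centre_eq_iff (hu : ‖u‖ = 1) (ht : ‖t‖ = 1) (htu : inner ℝ t u = 0) (a b : ℝ)
    {r : ℝ} (hr : 0 ≤ r) :
    dist (x + a • u + b • t) (x - r • u) = r ↔ a ^ 2 + b ^ 2 + 2 * a * r = 0 := by
  have h : x + a • u + b • t - (x - r • u) = (a + r) • u + b • t := by module
  rw [dist_eq_norm, h, ← sq_eq_sq₀ (norm_nonneg _) hr, norm_sq_plane hu ht htu]
  constructor <;> intro h <;> linarith

/-- For `a < 0` the circle condition is a linear equation in the radius with exactly one solution,
so the infimum runs over a single value. -/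
theorem circleRadius_eq (hu : ‖u‖ = 1) (ht : ‖t‖ = 1) (htu : inner ℝ t u = 0) {a b : ℝ}
    (ha : a < 0) :
    circleRadius x u (x + a • u + b • t) = ENNReal.ofReal ((a ^ 2 + b ^ 2) / (-2 * a)) := by
  have hpos : 0 ≤ (a ^ 2 + b ^ 2) / (-2 * a) := div_nonneg (by positivity) (by linarith)
  have key : ∀ r : ℝ≥0, dist (x + a • u + b • t) (x - (r : ℝ) • u) = r ↔
      r = ((a ^ 2 + b ^ 2) / (-2 * a)).toNNReal := by
    intro r
    rw [dist_centre_eq_iff hu ht htu a b r.coe_nonneg, ← NNReal.coe_inj, Real.coe_toNNReal _ hpos,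
      eq_div_iff (by linarith)]
    constructor <;> intro h <;> linarith
  simp only [circleRadius, key, iInf_iInf_eq_left]
  rfl

variable (K : ConvexBody (Eu n))

theorem isCompact_planeProjection (x u t : Eu n) : IsCompact (planeProjection K x u t) :=
  K.isCompact.image (by fun_prop)

theorem convex_planeProjection (x u t : Eu n) : Convex ℝ (planeProjection K x u t) := by
  have h : planeProjection K x u t = (fun z => x + z) ''
      ((Submodule.span ℝ {u, t}).starProjection '' ((fun y => -x + y) '' (K : Set (Eu n)))) := by
    rw [Set.image_image, Set.image_image]
    refine Set.image_congr fun y _ => ?_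
    rw [sub_eq_neg_add]
  rw [h]
  exact ((K.convex.translate (-x)).linear_image
    (Submodule.span ℝ {u, t}).starProjection.toLinearMap).translate x

theorem mem_planeProjection_of_mem {a b : ℝ} (h : x + a • u + b • t ∈ (K : Set (Eu n))) :
    x + a • u + b • t ∈ planeProjection K x u t := by
  refine ⟨_, h, ?_⟩
  have h1 : x + a • u + b • t - x = a • u + b • t := by abel
  have h2 : a • u + b • t ∈ Submodule.span ℝ {u, t} := Submodule.mem_span_pair.2 ⟨a, b, rfl⟩
  simp only [h1, Submodule.starProjection_eq_self_iff.2 h2]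
  rw [add_assoc]

theorem exists_coord_of_mem_planeProjection {z : Eu n} (hz : z ∈ planeProjection K x u t) :
    ∃ a b : ℝ, z = x + a • u + b • t := by
  obtain ⟨y, -, rfl⟩ := hz
  obtain ⟨a, b, h⟩ := Submodule.mem_span_pair.1
    (Submodule.starProjection_apply_mem (Submodule.span ℝ {u, t}) (y - x))
  exact ⟨a, b, by simp only [← h, add_assoc]⟩

theorem exists_mem_inner_eq_of_mem_planeProjection {z : Eu n}
    (hz : z ∈ planeProjection K x u t) : ∃ y ∈ (K : Set (Eu n)), ∀ c d : ℝ,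
      inner ℝ (y - x) (c • u + d • t) = inner ℝ (z - x) (c • u + d • t) := by
  obtain ⟨y, hy, rfl⟩ := hz
  refine ⟨y, hy, fun c d => ?_⟩
  have := Submodule.starProjection_inner_eq_zero (K := Submodule.span ℝ {u, t}) (y - x)
    (c • u + d • t) (Submodule.mem_span_pair.2 ⟨c, d, rfl⟩)
  rw [inner_sub_left] at this
  simp only [add_sub_cancel_left]
  linarith

theorem inner_nonpos_of_mem_planeProjection {z : Eu n} (hz : z ∈ planeProjection K x u t)
    {c d : ℝ} (h : IsNormalAt (K : Set (Eu n)) x (c • u + d • t)) :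
    inner ℝ (z - x) (c • u + d • t) ≤ 0 := by
  obtain ⟨y, hy, hyz⟩ := exists_mem_inner_eq_of_mem_planeProjection K hz
  rw [← hyz, inner_sub_left]
  linarith [h.2 y hy]

variable {K}

/-- Two outer unit normal vectors of a body of constant width at the same point enclose an angle of
at most sixty degrees. -/
theorem IsUnitWidth.half_le_inner {W : Set (Eu n)} (hW : IsUnitWidth W) {w : Eu n} (hu : ‖u‖ = 1)
    (hw : ‖w‖ = 1) (hxu : IsNormalAt W x u) (hxw : IsNormalAt W x w) : 1 / 2 ≤ inner ℝ w u := by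
  have h1 := hW.norm_sub_le _ (hW.sub_mem hu hxu) _ (hW.sub_mem hw hxw)
  have h2 : x - u - (x - w) = w - u := by abel
  rw [h2] at h1
  have h3 : ‖w - u‖ ^ 2 ≤ 1 := pow_le_one₀ (norm_nonneg _) h1
  rw [norm_sub_sq_real, hu, hw] at h3
  linarith

/-- Otherwise `t` would be a normal at `x` orthogonal to `u`, against the sixty degree bound. -/
theorem IsUnitWidth.exists_pos_coord (hK : IsUnitWidth (K : Set (Eu n))) (hu : ‖u‖ = 1)
    (ht : ‖t‖ = 1) (htu : inner ℝ t u = 0) (hx : IsNormalAt (K : Set (Eu n)) x u) :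
    ∃ a b : ℝ, 0 < b ∧ x + a • u + b • t ∈ planeProjection K x u t := by
  by_contra! hcon
  have : IsNormalAt (K : Set (Eu n)) x t := by
    refine ⟨hx.1, fun q hq => ?_⟩
    have hz : x + (Submodule.span ℝ {u, t}).starProjection (q - x) ∈ planeProjection K x u t :=
      ⟨q, hq, rfl⟩
    obtain ⟨a, b, hab⟩ := exists_coord_of_mem_planeProjection K hz
    have hb : b ≤ 0 := by
      by_contra! hb
      exact hcon a b hb (hab ▸ hz)
    have h1 : (Submodule.span ℝ {u, t}).starProjection (q - x) = a • u + b • t := by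
      rw [add_assoc] at hab; exact add_left_cancel hab
    have h2 := Submodule.starProjection_inner_eq_zero (K := Submodule.span ℝ {u, t}) (q - x) t
      (Submodule.subset_span (by simp))
    rw [h1, inner_sub_left, inner_plane_right ht htu, inner_sub_left] at h2
    linarith
  have := hK.half_le_inner hu ht hx this
  linarith

/-- The relative boundary of the projection accumulates at the support point, from the side of
any tangential direction. -/
theorem IsUnitWidth.neBot_nhdsWithin (hK : IsUnitWidth (K : Set (Eu n))) (hu : ‖u‖ = 1)
    (ht : ‖t‖ = 1) (htu : inner ℝ t u = 0) (hx : IsNormalAt (K : Set (Eu n)) x u) :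
    (𝓝[openHalfplane x u t ∩ intrinsicFrontier ℝ (planeProjection K x u t)] x).NeBot := by
  rw [← mem_closure_iff_nhdsWithin_neBot, Metric.mem_closure_iff]
  intro ε hε
  obtain ⟨a, b, hb, hab⟩ := hK.exists_pos_coord hu ht htu hx
  set P := planeProjection K x u t with hP
  have hxP : x ∈ P := by
    have : x + (0 : ℝ) • u + (0 : ℝ) • t ∈ P := mem_planeProjection_of_mem K (by simpa using hx.1)
    simpa using this
  have hxuP : x - u ∈ P := by
    have : x + (-1 : ℝ) • u + (0 : ℝ) • t ∈ P := by
      refine mem_planeProjection_of_mem K ?_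
      have := hK.sub_mem hu hx
      simpa [← sub_eq_add_neg] using this
    simpa [← sub_eq_add_neg] using this
  have hnonpos : ∀ c d : ℝ, x + c • u + d • t ∈ P → c ≤ 0 := by
    intro c d h
    have h1 := inner_nonpos_of_mem_planeProjection K h (c := 1) (d := 0) (by simpa using hx)
    have h2 : x + c • u + d • t - x = c • u + d • t := by abel
    rw [h2, one_smul, zero_smul, add_zero, inner_plane_left hu htu] at h1
    exact h1
  obtain ⟨s, hs0, hs1, hs⟩ : ∃ s : ℝ, 0 < s ∧ s ≤ 1 ∧ s * (|a| + b) < ε := by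
    have hpos : 0 < |a| + b := by positivity
    refine ⟨min 1 (ε / (|a| + b) / 2), by positivity, min_le_left _ _, ?_⟩
    calc min 1 (ε / (|a| + b) / 2) * (|a| + b) ≤ ε / (|a| + b) / 2 * (|a| + b) := by
          gcongr; exact min_le_right _ _
      _ = ε / 2 := by field_simp
      _ < ε := by linarith
  have ha := hnonpos a b hab
  have hstart : x + (s * a) • u + (s * b) • t ∈ P := by
    have := (convex_planeProjection K x u t) hxP hab (a := 1 - s) (b := s) (by linarith) hs0.le
      (by ring)
    convert this using 1
    module
  -- The highest point of `P` above abscissa `s * b` is a boundary point, since the ray in direction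
  -- `u` leaves `P` there. Heights above `0` need no attention, as `u` is a normal at `x`.
  set T : Set ℝ := Set.Icc (s * a) 0 ∩ {c | x + c • u + (s * b) • t ∈ P} with hT
  have hTc : IsCompact T := isCompact_Icc.inter_right
    ((isCompact_planeProjection K x u t).isClosed.preimage
      (f := fun c : ℝ => x + c • u + (s * b) • t) (by fun_prop))
  have hTne : T.Nonempty :=
    ⟨s * a, ⟨le_rfl, mul_nonpos_of_nonneg_of_nonpos hs0.le ha⟩, hstart⟩
  obtain ⟨c, hcT, hcmax⟩ := hTc.exists_isGreatest hTne
  refine ⟨x + c • u + (s * b) • t, ⟨⟨c, s * b, by positivity, rfl⟩, ?_⟩, ?_⟩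
  · refine mem_intrinsicFrontier_of_ray hcT.2 (d := u) (fun r => ?_) fun r hr hmem => ?_
    · have h1 : u ∈ (affineSpan ℝ P).direction := by
        have := AffineSubspace.vsub_mem_direction (subset_affineSpan ℝ P hxP)
          (subset_affineSpan ℝ P hxuP)
        simpa using this
      have h2 := AffineSubspace.vadd_mem_of_mem_direction
        (Submodule.smul_mem _ r h1) (subset_affineSpan ℝ P hcT.2)
      rwa [vadd_eq_add, add_comm] at h2
    · have h1 : x + c • u + (s * b) • t + r • u = x + (c + r) • u + (s * b) • t := by module
      rw [h1] at hmem
      have h2 := hnonpos _ _ hmem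
      have := hcmax ⟨⟨by linarith [hcT.1.1], h2⟩, hmem⟩
      linarith
  · have h1 : x - (x + c • u + (s * b) • t) = -(c • u + (s * b) • t) := by abel
    rw [dist_eq_norm, h1, norm_neg]
    calc ‖c • u + (s * b) • t‖ ≤ |c| + s * b := by
          refine (norm_add_le _ _).trans ?_
          rw [norm_smul, norm_smul, hu, ht, Real.norm_eq_abs, Real.norm_eq_abs,
            abs_of_pos (mul_pos hs0 hb)]
          linarith
      _ ≤ s * |a| + s * b := by
          rw [abs_of_nonpos hcT.1.2, abs_of_nonpos ha]
          linarith [hcT.1.1]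
      _ < ε := by linarith

theorem IsUnitWidth.tangentialRadiusEq_of_tendsto (hK : IsUnitWidth (K : Set (Eu n)))
    (hu : ‖u‖ = 1) (ht : ‖t‖ = 1) (htu : inner ℝ t u = 0) (hx : IsNormalAt (K : Set (Eu n)) x u)
    {r : ℝ≥0∞}
    (h : Tendsto (circleRadius x u)
      (𝓝[openHalfplane x u t ∩ intrinsicFrontier ℝ (planeProjection K x u t)] x) (𝓝 r)) :
    TangentialRadiusEq K u t r :=
  haveI := hK.neBot_nhdsWithin hu ht htu hx
  ⟨x, hK.supportSet_eq hu hx, h.liminf_eq, h.limsup_eq⟩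

/-- At a boundary point with two different outer unit normal vectors, the radius of curvature
vanishes in the direction from the first to the second normal vector. -/
theorem IsUnitWidth.exists_tangentialRadiusEq_zero (hK : IsUnitWidth (K : Set (Eu n))) {w : Eu n}
    (hu : ‖u‖ = 1) (hw : ‖w‖ = 1) (hxu : IsNormalAt (K : Set (Eu n)) x u)
    (hxw : IsNormalAt (K : Set (Eu n)) x w) (hwu : w ≠ u) :
    ∃ t : Eu n, ‖t‖ = 1 ∧ inner ℝ t u = 0 ∧ TangentialRadiusEq K u t 0 := by
  set a := inner ℝ w u with ha
  have ha2 : 1 / 2 ≤ a := hK.half_le_inner hu hw hxu hxw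
  have hne : w - a • u ≠ 0 := by
    intro h0
    rw [sub_eq_zero] at h0
    have h1 : |a| = 1 := by
      have := congrArg norm h0
      rwa [hw, norm_smul, hu, mul_one, Real.norm_eq_abs, eq_comm] at this
    rw [abs_of_pos (by linarith)] at h1
    rw [h1, one_smul] at h0
    exact hwu h0
  set b := ‖w - a • u‖ with hb
  have hb0 : 0 < b := norm_pos_iff.2 hne
  set t := b⁻¹ • (w - a • u) with ht'
  have ht : ‖t‖ = 1 := norm_smul_inv_norm hne
  have htu : inner ℝ t u = 0 := by
    rw [ht', inner_smul_left, inner_sub_left, inner_smul_left, real_inner_self_eq_norm_sq, hu, ← ha]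
    simp
  have hwt : w = a • u + b • t := by
    rw [ht', smul_smul, mul_inv_cancel₀ hb0.ne', one_smul]; abel
  refine ⟨t, ht, htu, hK.tangentialRadiusEq_of_tendsto hu ht htu hxu ?_⟩
  -- The second normal gives `a * α + b * β ≤ 0`, so `0 < β ≤ (a / b) * (-α)` and the radius `(α ^ 2
  -- + β ^ 2) / (-2 * α)` is at most `C * (-α)`.
  set C := (1 + (a / b) ^ 2) / 2 with hC
  have hbound : ∀ᶠ z in 𝓝[openHalfplane x u t ∩ intrinsicFrontier ℝ (planeProjection K x u t)] x,
      circleRadius x u z ≤ ENNReal.ofReal (C * ‖z - x‖) := by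
    filter_upwards [self_mem_nhdsWithin] with z hz
    obtain ⟨⟨α, β, hβ, rfl⟩, hzf⟩ := hz
    have hzP := intrinsicFrontier_subset (isCompact_planeProjection K x u t).isClosed hzf
    have hsub : x + α • u + β • t - x = α • u + β • t := by abel
    have h1 := inner_nonpos_of_mem_planeProjection K hzP (c := a) (d := b) (hwt ▸ hxw)
    rw [hsub, inner_add_right, inner_smul_right, inner_smul_right, inner_plane_left hu htu,
      inner_plane_right ht htu] at h1
    have hα : α < 0 := by
      by_contra! hα
      have : 0 < b * β := mul_pos hb0 hβ
      have : 0 ≤ a * α := mul_nonneg (by linarith) hα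
      linarith
    rw [circleRadius_eq hu ht htu hα, hsub]
    refine ENNReal.ofReal_le_ofReal ?_
    have hαn : -α ≤ ‖α • u + β • t‖ := by
      have h2 := abs_real_inner_le_norm (α • u + β • t) u
      rw [inner_plane_left hu htu, hu, mul_one, abs_of_neg hα] at h2
      exact h2
    have hβα : β ≤ a / b * (-α) := by
      rw [div_mul_eq_mul_div, le_div_iff₀ hb0]; linarith
    have hβ2 : β ^ 2 ≤ (a / b) ^ 2 * α ^ 2 := by
      calc β ^ 2 ≤ (a / b * (-α)) ^ 2 := by gcongr
        _ = _ := by ring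
    calc (α ^ 2 + β ^ 2) / (-2 * α) ≤ C * (-α) := by
          rw [div_le_iff₀ (by linarith), hC]
          nlinarith
      _ ≤ C * ‖α • u + β • t‖ := by gcongr
  refine tendsto_of_tendsto_of_tendsto_of_le_of_le' tendsto_const_nhds ?_
    (Eventually.of_forall fun _ => zero_le) hbound
  have hcont : Continuous fun z : Eu n => ENNReal.ofReal (C * ‖z - x‖) :=
    ENNReal.continuous_ofReal.comp (by fun_prop)
  have := hcont.tendsto x
  simp only [sub_self, norm_zero, mul_zero, ENNReal.ofReal_zero] at this
  exact this.mono_left nhdsWithin_le_nhds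

/-- If a body of constant width contains a spherical cap of radius one around a boundary point, then
all tangential radii of curvature at that point are equal to one. -/
theorem IsUnitWidth.tangentialRadiusEq_one (hK : IsUnitWidth (K : Set (Eu n)))
    (hu : ‖u‖ = 1) (hx : IsNormalAt (K : Set (Eu n)) x u)
    (hcap : ∀ᶠ w in 𝓝 u, ‖w‖ = 1 → x - u + w ∈ (K : Set (Eu n)))
    (ht : ‖t‖ = 1) (htu : inner ℝ t u = 0) : TangentialRadiusEq K u t 1 := by
  refine hK.tangentialRadiusEq_of_tendsto hu ht htu hx (tendsto_const_nhds.congr' ?_)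
  set c := x - u with hc
  have hcK : c ∈ (K : Set (Eu n)) := hK.sub_mem hu hx
  have hxc : x - c = u := by rw [hc]; abel
  -- Joining the cap to the centre `c ∈ K` by segments fills the unit ball around `c` near `x`.
  have hsector : ∀ᶠ z in 𝓝 x, ‖z - c‖ ≤ 1 → z ∈ (K : Set (Eu n)) := by
    have hcont : ContinuousAt (fun z : Eu n => ‖z - c‖⁻¹ • (z - c)) x := by
      have hsub : ContinuousAt (fun z : Eu n => z - c) x := by fun_prop
      refine (hsub.norm.inv₀ ?_).smul hsub
      rw [hxc, hu]; exact one_ne_zero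
    have hlim : Tendsto (fun z : Eu n => ‖z - c‖⁻¹ • (z - c)) (𝓝 x) (𝓝 u) := by
      have := hcont.tendsto
      simpa [hxc, hu] using this
    have hne : ∀ᶠ z in 𝓝 x, z ≠ c := by
      refine eventually_ne_nhds fun h => ?_
      rw [h, sub_self] at hxc
      rw [← hxc, norm_zero] at hu
      exact zero_ne_one hu
    filter_upwards [hlim.eventually hcap, hne] with z hz hzc hz1
    have hz0 : z - c ≠ 0 := sub_ne_zero.2 hzc
    have hn : ‖z - c‖ ≠ 0 := norm_ne_zero_iff.2 hz0
    have hmem := hz (norm_smul_inv_norm hz0)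
    have := K.convex hcK hmem (a := 1 - ‖z - c‖) (b := ‖z - c‖) (by linarith) (norm_nonneg _)
      (by ring)
    convert this using 1
    rw [smul_add, smul_smul, mul_inv_cancel₀ hn, one_smul, ← add_assoc, ← add_smul]
    simp
  filter_upwards [nhdsWithin_le_nhds hsector.eventually_nhds, self_mem_nhdsWithin] with z hz hzmem
  obtain ⟨⟨α, β, hβ, rfl⟩, hzf⟩ := hzmem
  set z := x + α • u + β • t with hzdef
  have hzP := intrinsicFrontier_subset (isCompact_planeProjection K x u t).isClosed hzf
  have hzc : z - c = (α + 1) • u + β • t := by rw [hzdef, hc]; module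
  -- As `z - c` lies in the plane of projection, a preimage `y` of `z` satisfies `⟪y - c, z - c⟫ =
  -- ‖z - c‖ ^ 2`, while `‖y - c‖ ≤ 1`.
  have hle : ‖z - c‖ ≤ 1 := by
    obtain ⟨y, hy, hyz⟩ := exists_mem_inner_eq_of_mem_planeProjection K hzP
    have h1 := hyz (α + 1) β
    have h2 : y - x = (y - c) - u := by rw [hc]; abel
    have h3 : z - x = (z - c) - u := by rw [hc]; abel
    rw [h2, h3, ← hzc, inner_sub_left, inner_sub_left (z - c), real_inner_self_eq_norm_sq] at h1
    have h4 := real_inner_le_norm (y - c) (z - c)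
    have h5 := hK.norm_sub_le y hy c hcK
    by_contra! hgt
    nlinarith [norm_nonneg (y - c)]
  have heq : ‖z - c‖ = 1 := by
    refine le_antisymm hle (not_lt.1 fun hlt => ?_)
    have hnear : ∀ᶠ y in 𝓝 z, ‖y - c‖ < 1 :=
      (show Continuous fun y : Eu n => ‖y - c‖ by fun_prop).continuousAt.eventually_lt
        continuousAt_const hlt
    refine not_mem_intrinsicFrontier_of_nhds
      (L := AffineSubspace.mk' x (Submodule.span ℝ {u, t})) ?_ (hz.and hnear) ?_ hzf
    · rintro y ⟨q, -, rfl⟩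
      rw [SetLike.mem_coe, AffineSubspace.mem_mk', vsub_eq_sub]
      simp only [add_sub_cancel_left]
      exact Submodule.starProjection_apply_mem _ _
    · rintro y ⟨⟨hy1, hy2⟩, hyL⟩
      rw [SetLike.mem_coe, AffineSubspace.mem_mk', vsub_eq_sub] at hyL
      obtain ⟨p, q, hpq⟩ := Submodule.mem_span_pair.1 hyL
      have hy : y = x + p • u + q • t := by rw [add_assoc, hpq]; abel
      have hyK := hy1 hy2.le
      rw [hy] at hyK ⊢
      exact mem_planeProjection_of_mem K hyK
  have hsq : (α + 1) ^ 2 + β ^ 2 = 1 := by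
    rw [← norm_sq_plane hu ht htu, ← hzc, heq, one_pow]
  have hα : α < 0 := by nlinarith [sq_nonneg α, pow_pos hβ 2]
  rw [hzdef, circleRadius_eq hu ht htu hα, eq_comm, ENNReal.ofReal_eq_one,
    div_eq_one_iff_eq (by linarith)]
  linarith

end Plane

/-! ### Approximation by finite intersections of unit balls. -/

section Approximation

variable {E : Type*} [NormedAddCommGroup E] [InnerProductSpace ℝ E]

/-- The Minkowski combination `(1 - l) W + l B` of `W` and the ball `B` of diameter one with
centre `c`. -/
def rounding (W : Set E) (c : E) (l : ℝ) : Set E :=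
  {z | ∃ x ∈ W, ∃ b : E, ‖b‖ ≤ 1 / 2 ∧ z = (1 - l) • x + l • (c + b)}

theorem norm_combination_le {l : ℝ} (hl0 : 0 ≤ l) (hl1 : l ≤ 1) (x y : E) :
    ‖(1 - l) • x + l • y‖ ≤ (1 - l) * ‖x‖ + l * ‖y‖ := by
  refine (norm_add_le _ _).trans ?_
  rw [norm_smul, norm_smul, Real.norm_of_nonneg (by linarith), Real.norm_of_nonneg hl0]

theorem IsUnitWidth.norm_sub_le_of_mem_rounding {W : Set E} (hW : IsUnitWidth W) {c : E} {l : ℝ}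
    (hl0 : 0 ≤ l) (hl1 : l ≤ 1) {y z : E} (hy : y ∈ rounding W c l) (hz : z ∈ rounding W c l) :
    ‖y - z‖ ≤ 1 := by
  obtain ⟨p, hp, b, hb, rfl⟩ := hy
  obtain ⟨q, hq, d, hd, rfl⟩ := hz
  have h : (1 - l) • p + l • (c + b) - ((1 - l) • q + l • (c + d)) =
      (1 - l) • (p - q) + l • (b - d) := by module
  rw [h]
  have h1 := norm_combination_le hl0 hl1 (p - q) (b - d)
  have h2 := hW.norm_sub_le p hp q hq
  have h3 : ‖b - d‖ ≤ 1 := (_root_.norm_sub_le b d).trans (by linarith)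
  nlinarith

/-- Rounding makes the distance of boundary points with normal vectors in a cap smaller than an
open hemisphere strictly less than the width. -/
theorem norm_rounding_sub_le {W : Set E} (hW : IsUnitWidth W) {c v : E} (hv : ‖v‖ = 1) {l : ℝ}
    (hl0 : 0 ≤ l) (hl1 : l ≤ 1) {x y u w : E} (hx : x ∈ W) (hy : y ∈ W) (hu : ‖u‖ = 1)
    (hw : ‖w‖ = 1) (huv : 1 / 4 ≤ inner ℝ u v) (hwv : 1 / 4 ≤ inner ℝ w v) :
    ‖((1 - l) • x + l • (c + (1 / 2 : ℝ) • u)) - ((1 - l) • y + l • (c + (1 / 2 : ℝ) • w))‖ ≤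
      1 - l / 32 := by
  have h : ((1 - l) • x + l • (c + (1 / 2 : ℝ) • u)) -
      ((1 - l) • y + l • (c + (1 / 2 : ℝ) • w)) =
      (1 - l) • (x - y) + l • ((1 / 2 : ℝ) • (u - w)) := by module
  rw [h]
  have h1 := norm_combination_le hl0 hl1 (x - y) ((1 / 2 : ℝ) • (u - w))
  have h2 := hW.norm_sub_le x hx y hy
  -- By the parallelogram law `‖u - w‖ ^ 2 ≤ 4 - 1 / 4`, slightly less than `(31 / 16) ^ 2`.
  have h3 : 1 / 2 ≤ ‖u + w‖ := by
    have := real_inner_le_norm (u + w) v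
    rw [inner_add_left, hv, mul_one] at this
    linarith
  have h4 : ‖u - w‖ ≤ 31 / 16 := by
    have := parallelogram_law_with_norm ℝ u w
    rw [hu, hw] at this
    nlinarith [norm_nonneg (u - w)]
  have h5 : ‖(1 / 2 : ℝ) • (u - w)‖ ≤ 31 / 32 := by
    rw [norm_smul, Real.norm_of_nonneg (by norm_num)]; linarith
  nlinarith

/-- A point `p` that is at least as far in direction `u` as `x`, and is at distance at most `1 + δ`
from `x - u`, is close to `x`. -/
theorem norm_sub_sq_le_of_inner_le {p x u : E} {δ : ℝ} (hu : ‖u‖ = 1)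
    (hpx : inner ℝ x u ≤ inner ℝ p u) (h : ‖p - (x - u)‖ ≤ 1 + δ) :
    ‖p - x‖ ^ 2 ≤ 2 * δ + δ ^ 2 := by
  have h1 : p - (x - u) = (p - x) + u := by abel
  have h2 : ‖(p - x) + u‖ ^ 2 ≤ (1 + δ) ^ 2 := by rw [← h1]; gcongr
  rw [norm_add_sq_real, hu, inner_sub_left] at h2
  nlinarith

/-- A body of constant width one is approximated by intersections of finitely many unit balls
with centres at mutual distance at most one, in such a way that the boundary points of the
intersection with a normal vector in a given cap have mutual distance at most one. -/
theorem IsUnitWidth.exists_finite_ballHull_approx [FiniteDimensional ℝ E] {W : ConvexBody E}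
    (hW : IsUnitWidth (W : Set E)) {v : E} (hv : ‖v‖ = 1) {ε : ℝ} (hε : 0 < ε) :
    ∃ X : Set E, X.Finite ∧ X.Nonempty ∧ (∀ x ∈ X, ∀ y ∈ X, ‖x - y‖ ≤ 1) ∧
      (∀ w ∈ (W : Set E), ∃ x ∈ X, ‖w - x‖ ≤ ε) ∧
      (∀ z ∈ ballHull X, ∃ w ∈ (W : Set E), ‖z - w‖ ≤ ε) ∧
      ∀ p q u w : E, ‖u‖ = 1 → ‖w‖ = 1 → 1 / 4 ≤ inner ℝ u v → 1 / 4 ≤ inner ℝ w v →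
        IsNormalAt (ballHull X) p u → IsNormalAt (ballHull X) q w → ‖p - q‖ ≤ 1 := by
  obtain ⟨c, hc⟩ := W.nonempty
  obtain ⟨l, hl0, hl1, hlε⟩ : ∃ l : ℝ, 0 < l ∧ l ≤ 1 ∧ 3 * l ≤ ε :=
    ⟨min 1 (ε / 3), by positivity, min_le_left _ _, by linarith [min_le_right 1 (ε / 3)]⟩
  -- The net moves each of two support points by at most `l / 64`, which together uses up exactly
  -- the gain `l / 32` from rounding.
  obtain ⟨δ, hδ0, hδl, hδ⟩ : ∃ δ : ℝ, 0 < δ ∧ δ ≤ l ∧ 2 * δ + δ ^ 2 ≤ (l / 64) ^ 2 := by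
    have hl2 : l ^ 2 ≤ l := by nlinarith
    have hl4 : (l ^ 2) ^ 2 ≤ l ^ 2 := pow_le_of_le_one (by positivity) (by linarith) two_ne_zero
    exact ⟨l ^ 2 / 12288, by positivity, by linarith, by linarith [sq_nonneg l]⟩
  set R := rounding (W : Set E) c l with hR
  have hRd : ∀ y ∈ R, ∀ z ∈ R, ‖y - z‖ ≤ 1 := fun y hy z hz =>
    hW.norm_sub_le_of_mem_rounding hl0.le hl1 hy hz
  have hmemR : ∀ x ∈ (W : Set E), ∀ b : E, ‖b‖ ≤ 1 / 2 → (1 - l) • x + l • (c + b) ∈ R :=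
    fun x hx b hb => ⟨x, hx, b, hb, rfl⟩
  have hcR : c ∈ R := by
    have := hmemR c hc 0 (by simp)
    rwa [add_zero, ← add_smul, sub_add_cancel, one_smul] at this
  obtain ⟨X, hXR, hXfin, hXcover⟩ : ∃ X ⊆ R, X.Finite ∧ ∀ y ∈ R, ∃ x ∈ X, ‖y - x‖ ≤ δ := by
    have hb : Bornology.IsBounded R := by
      refine Metric.isBounded_closedBall.subset (t := Metric.closedBall c 1) fun y hy => ?_
      simpa [dist_eq_norm] using hRd y hy c hcR
    obtain ⟨X, hXR, hXfin, hX⟩ :=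
      exists_finite_cover_balls_of_isCompact_closure hb.isCompact_closure hδ0
    refine ⟨X, hXR, hXfin, fun y hy => ?_⟩
    obtain ⟨x, hx, hyx⟩ := Set.mem_iUnion₂.1 (hX hy)
    exact ⟨x, hx, by simpa [dist_eq_norm] using (Metric.mem_ball.1 hyx).le⟩
  have hRP : R ⊆ ballHull X := fun y hy x hx => hRd y hy x (hXR hx)
  have hnear : ∀ z ∈ ballHull X, ∀ y ∈ R, ‖z - y‖ ≤ 1 + δ := by
    intro z hz y hy
    obtain ⟨x, hx, hyx⟩ := hXcover y hy
    have h1 := norm_sub_le_norm_sub_add_norm_sub z x y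
    rw [norm_sub_rev x y] at h1
    linarith [hz x hx]
  have hhalf : ∀ u : E, ‖u‖ = 1 → ‖(1 / 2 : ℝ) • u‖ ≤ 1 / 2 := fun u hu => by
    rw [norm_smul, hu, Real.norm_of_nonneg (by norm_num), mul_one]
  have hlow : ∀ x u : E, (1 - l) • (x - u) + l • (c + -((1 / 2 : ℝ) • u)) =
      (1 - l) • x + l • (c + (1 / 2 : ℝ) • u) - u := fun x u => by module
  refine ⟨X, hXfin, ?_, fun x hx y hy => hRd x (hXR hx) y (hXR hy), ?_, ?_, ?_⟩
  · obtain ⟨x, hx, -⟩ := hXcover c hcR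
    exact ⟨x, hx⟩
  · intro w hw
    obtain ⟨x, hx, hwx⟩ := hXcover _ (hmemR w hw 0 (by simp))
    refine ⟨x, hx, ?_⟩
    have h1 : w - ((1 - l) • w + l • (c + 0)) = l • (w - c) := by module
    have h2 : ‖w - ((1 - l) • w + l • (c + 0))‖ ≤ l := by
      rw [h1, norm_smul, Real.norm_of_nonneg hl0.le]
      have := hW.norm_sub_le w hw c hc
      nlinarith
    have h3 := norm_sub_le_norm_sub_add_norm_sub w ((1 - l) • w + l • (c + 0)) x
    linarith
  · intro z hz
    obtain ⟨q, hq, hmin⟩ := exists_norm_eq_iInf_of_complete_convex W.nonempty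
      W.isCompact.isComplete W.convex z
    rw [norm_eq_iInf_iff_real_inner_le_zero W.convex hq] at hmin
    refine ⟨q, hq, ?_⟩
    rcases eq_or_ne (z - q) 0 with h0 | h0
    · rw [h0, norm_zero]; exact hε.le
    have hn : 0 < ‖z - q‖ := norm_pos_iff.2 h0
    set u := ‖z - q‖⁻¹ • (z - q) with hu'
    have hu : ‖u‖ = 1 := norm_smul_inv_norm h0
    obtain ⟨x, hx, hxu⟩ := hW.exists_sub_mem u hu
    have h1 : inner ℝ x u ≤ inner ℝ q u := by
      have h := hmin x hx
      have h2 : inner ℝ (x - q) u ≤ 0 := by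
        rw [hu', inner_smul_right, real_inner_comm]
        exact mul_nonpos_of_nonneg_of_nonpos (by positivity) h
      rw [inner_sub_left] at h2; linarith
    -- The point `y` of `R` is within `2 * l` of `x - u` and `z` within `1 + δ` of `y`. Hence `z`
    -- exceeds the height of `x` in direction `u` by at most `2 * l + δ ≤ 3 * l`.
    set y := (1 - l) • (x - u) + l • (c + -((1 / 2 : ℝ) • u)) with hy
    have hyR : y ∈ R := hmemR _ hxu _ (by rw [norm_neg]; exact hhalf u hu)
    have h2 := hnear z hz y hyR
    have h3 : y - (x - u) = l • ((c - x) + (1 / 2 : ℝ) • u) := by rw [hy]; module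
    have h4 : ‖y - (x - u)‖ ≤ 2 * l := by
      rw [h3, norm_smul, Real.norm_of_nonneg hl0.le]
      have h5 := norm_add_le (c - x) ((1 / 2 : ℝ) • u)
      have h6 := hW.norm_sub_le c hc x hx
      have h7 := hhalf u hu
      nlinarith
    have h5 := norm_sub_le_norm_sub_add_norm_sub z y (x - u)
    have h6 := real_inner_le_norm (z - (x - u)) u
    rw [hu, mul_one, inner_sub_left, inner_sub_left, real_inner_self_eq_norm_sq, hu] at h6
    have h7 : inner ℝ (z - q) u = ‖z - q‖ := by
      rw [hu', inner_smul_right, real_inner_self_eq_norm_sq]; field_simp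
    rw [inner_sub_left] at h7
    linarith
  · intro p q u w hu hw huv hwv hp hq
    -- Both the support point of `R` for `u` and its antipode lie in `R`. The first bounds the
    -- height of `p` from below, the second confines `p` to a ball of radius `1 + δ`.
    have hclose : ∀ p u : E, ‖u‖ = 1 → IsNormalAt (ballHull X) p u → ∃ x ∈ (W : Set E),
        ‖p - ((1 - l) • x + l • (c + (1 / 2 : ℝ) • u))‖ ≤ l / 64 := by
      intro p u hu hp
      obtain ⟨x, hx, hxu⟩ := hW.exists_sub_mem u hu
      refine ⟨x, hx, ?_⟩
      have h1 := hp.2 _ (hRP (hmemR x hx _ (hhalf u hu)))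
      have h2 := hnear p hp.1 _ (hmemR _ hxu (-((1 / 2 : ℝ) • u))
        (by rw [norm_neg]; exact hhalf u hu))
      rw [hlow] at h2
      have h3 := (norm_sub_sq_le_of_inner_le hu h1 h2).trans hδ
      exact (sq_le_sq₀ (norm_nonneg _) (by positivity)).1 h3
    obtain ⟨x, hx, hpx⟩ := hclose p u hu hp
    obtain ⟨y, hy, hqy⟩ := hclose q w hw hq
    have h1 := norm_rounding_sub_le hW (c := c) hv hl0.le hl1 hx hy hu hw huv hwv
    set x₁ := (1 - l) • x + l • (c + (1 / 2 : ℝ) • u)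
    set y₁ := (1 - l) • y + l • (c + (1 / 2 : ℝ) • w)
    have h2 := norm_sub_le_norm_sub_add_norm_sub p x₁ q
    have h3 := norm_sub_le_norm_sub_add_norm_sub x₁ y₁ q
    rw [norm_sub_rev y₁ q] at h3
    linarith

/-- At a boundary point `x` with outer unit normal vector `u` of an intersection of finitely many
unit balls, either `x` is in the boundary of one of the balls but `u` is not a normal vector of that
ball at `x`, or the intersection coincides near `x` with the ball with centre `x - u`. -/
theorem IsNormalAt.exists_ne_or_eventually_mem {X : Set E} (hX : X.Finite) {x u : E}
    (hu : ‖u‖ = 1) (hx : IsNormalAt (ballHull X) x u) :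
    (∃ i ∈ X, ‖x - i‖ = 1 ∧ x - i ≠ u) ∨
      (x - u ∈ X ∧ ∀ᶠ y in 𝓝 x, ‖y - (x - u)‖ ≤ 1 → y ∈ ballHull X) := by
  by_cases hex : ∃ i ∈ X, ‖x - i‖ = 1 ∧ x - i ≠ u
  · exact Or.inl hex
  push Not at hex
  have hinact : ∀ᶠ y in 𝓝 x, ∀ i ∈ X, ‖x - i‖ < 1 → ‖y - i‖ < 1 := by
    refine (hX.eventually_all).2 fun i _ => ?_
    by_cases hi : ‖x - i‖ < 1
    · have : Continuous fun y : E => ‖y - i‖ := by fun_prop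
      filter_upwards [this.continuousAt.eventually_lt continuousAt_const hi] with y hy _ using hy
    · exact Eventually.of_forall fun _ h => absurd h hi
  have hact : ∀ i ∈ X, ¬ ‖x - i‖ < 1 → i = x - u := by
    intro i hi hlt
    have := hex i hi (le_antisymm (hx.1 i hi) (not_lt.1 hlt))
    rw [← this, sub_sub_cancel]
  refine Or.inr ⟨?_, ?_⟩
  -- Without the centre `x - u` no sphere passes through `x`, so `x` can be moved along `u` inside
  -- the hull.
  · by_contra hxu
    have hstrict : ∀ i ∈ X, ‖x - i‖ < 1 := fun i hi => by
      by_contra h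
      exact hxu (hact i hi h ▸ hi)
    have hlim : Tendsto (fun s : ℝ => x + s • u) (𝓝[>] 0) (𝓝 x) := by
      have : Continuous fun s : ℝ => x + s • u := by fun_prop
      have h := this.tendsto 0
      rw [zero_smul, add_zero] at h
      exact h.mono_left nhdsWithin_le_nhds
    obtain ⟨s, hs, hs0⟩ := ((hlim.eventually hinact).and self_mem_nhdsWithin).exists
    have h1 := hx.2 (x + s • u) fun i hi => (hs i hi (hstrict i hi)).le
    rw [inner_add_left, inner_smul_left, real_inner_self_eq_norm_sq, hu] at h1
    have hs0' : 0 < s := hs0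
    simp at h1
    linarith
  · filter_upwards [hinact] with y hy hyu i hi
    by_cases h : ‖x - i‖ < 1
    · exact (hy i hi h).le
    · rwa [hact i hi h]

/-- If a set contained in the unit ball with centre `i` contains the boundary point `i + w` of the
ball, then `w` is an outer normal vector of the set at this point. -/
theorem isNormalAt_of_forall_norm_sub_le {Q : Set E} {i w : E} (hw : ‖w‖ = 1) (hmem : i + w ∈ Q)
    (hQ : ∀ q ∈ Q, ‖q - i‖ ≤ 1) : IsNormalAt Q (i + w) w := by
  refine ⟨hmem, fun q hq => ?_⟩
  have h1 := real_inner_le_norm (q - i) w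
  rw [hw, mul_one, inner_sub_left] at h1
  rw [inner_add_left, real_inner_self_eq_norm_sq, hw]
  linarith [hQ q hq]

end Approximation

end ConstWidth

/-! ### Construction of the body and the dichotomy. -/

theorem mainTheorem4 (n : ℕ) (W₀ : ConvexBody (EuclideanSpace ℝ (Fin n)))
    (hW₀ : ConstWidth.HasConstantWidth W₀ 1)
    (v : EuclideanSpace ℝ (Fin n)) (hv : ‖v‖ = 1) (ε : ℝ) (hε : 0 < ε) :
    ∃ Q : ConvexBody (EuclideanSpace ℝ (Fin n)),
      ConstWidth.HasConstantWidth Q 1 ∧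
      Metric.hausdorffDist (W₀ : Set (EuclideanSpace ℝ (Fin n))) Q ≤ ε ∧
      ∀ u : EuclideanSpace ℝ (Fin n), ‖u‖ = 1 → 1 / 2 ≤ inner ℝ u v →
        (∀ t : EuclideanSpace ℝ (Fin n), ‖t‖ = 1 → inner ℝ t u = 0 →
          ConstWidth.TangentialRadiusEq Q u t 1) ∨
        (∃ t : EuclideanSpace ℝ (Fin n), ‖t‖ = 1 ∧ inner ℝ t u = 0 ∧
          ConstWidth.TangentialRadiusEq Q u t 0) := by
  open ConstWidth in
  have hW := (hasConstantWidth_one_iff W₀).1 hW₀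
  obtain ⟨X, hXfin, hXne, hXd, hWX, hXW, hcap⟩ := hW.exists_finite_ballHull_approx hv hε
  -- The bound `1 / 4`, in place of `1 / 2`, leaves room for all normals near a given `u`, as needed
  -- for a whole spherical cap in `Q`.
  set A : Set (Eu n) :=
    {p | ∃ u : Eu n, ‖u‖ = 1 ∧ 1 / 4 ≤ inner ℝ u v ∧ IsNormalAt (ballHull X) p u}
  obtain ⟨Q, hSQ, hQ⟩ := exists_convexBody_isUnitWidth (S := X ∪ A)
    (hXne.mono Set.subset_union_left) (by
      rintro x (hx | ⟨u, hu, huv, hxu⟩) y (hy | ⟨w, hw, hwv, hyw⟩)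
      · exact hXd x hx y hy
      · rw [norm_sub_rev]; exact hyw.1 x hx
      · exact hxu.1 y hy
      · exact hcap x y u w hu hw huv hwv hxu hyw)
  have hXQ : X ⊆ Q := Set.subset_union_left.trans hSQ
  have hAQ : A ⊆ Q := Set.subset_union_right.trans hSQ
  have hQP : (Q : Set (Eu n)) ⊆ ballHull X := fun q hq i hi => hQ.norm_sub_le q hq i (hXQ hi)
  refine ⟨Q, (hasConstantWidth_one_iff Q).2 hQ, ?_, fun u hu huv => ?_⟩
  · refine Metric.hausdorffDist_le_of_mem_dist hε.le (fun w hw => ?_) fun q hq => ?_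
    · obtain ⟨x, hx, h⟩ := hWX w hw
      exact ⟨x, hXQ hx, by rwa [dist_eq_norm]⟩
    · obtain ⟨w, hw, h⟩ := hXW q (hQP hq)
      exact ⟨w, hw, by rwa [dist_eq_norm]⟩
  obtain ⟨x, hxP, hmax⟩ := (isCompact_ballHull hXne).exists_isMaxOn
    (Q.nonempty.mono hQP) (f := fun y : Eu n => inner ℝ y u) (by fun_prop)
  have hxP : IsNormalAt (ballHull X) x u := ⟨hxP, fun q hq => hmax hq⟩
  -- The support point of the hull belongs to `A ⊆ Q`, so it is also the support point of the
  -- smaller set `Q`.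
  have hxQ : IsNormalAt (Q : Set (Eu n)) x u :=
    ⟨hAQ ⟨u, hu, by linarith, hxP⟩, fun q hq => hxP.2 q (hQP hq)⟩
  rcases hxP.exists_ne_or_eventually_mem hXfin hu with ⟨i, hi, hi1, hiu⟩ | ⟨hcX, hloc⟩
  · right
    have hxi : IsNormalAt (Q : Set (Eu n)) x (x - i) := by
      have := isNormalAt_of_forall_norm_sub_le (Q := (Q : Set (Eu n))) (i := i) hi1
        (by rw [add_sub_cancel]; exact hxQ.1) fun q hq => hQP hq i hi
      rwa [add_sub_cancel] at this
    exact hQ.exists_tangentialRadiusEq_zero hu hi1 hxQ hxi hiu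
  · left
    intro t ht htu
    refine hQ.tangentialRadiusEq_one hu hxQ ?_ ht htu
    have hlim : Tendsto (fun w : Eu n => x - u + w) (𝓝 u) (𝓝 x) := by
      have h : Continuous fun w : Eu n => x - u + w := by fun_prop
      simpa using h.tendsto u
    have hnear : ∀ᶠ w : Eu n in 𝓝 u, 1 / 4 < inner ℝ w v := by
      have h : Continuous fun w : Eu n => inner ℝ w v := by fun_prop
      exact continuousAt_const.eventually_lt h.continuousAt (by linarith)
    filter_upwards [hlim.eventually hloc, hnear] with w hw hwv hw1
    have hmem : x - u + w ∈ ballHull X := hw (by rw [add_sub_cancel_left, hw1])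
    exact hAQ ⟨w, hw1, hwv.le, isNormalAt_of_forall_norm_sub_le hw1 hmem fun q hq => hq _ hcX⟩
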